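/- Let $S_n$ be the set of permutations of $\{1,\dots,n\}$, where $n\ge 0$. A permutation $\pi=\pi_1\cdots\pi_n\in S_n$ contains $\sigma\in S_k$ as a pattern if there are $i_1<\dots<i_k$ such that $\pi_{i_1}\cdots\pi_{i_k}$ is order-isomorphic to $\sigma_1\cdots\sigma_k$; otherwise $\pi$ avoids $\sigma$. Let $\mathrm{Av}_n(\sigma)$ be the set of permutations in $S_n$ that avoid $\sigma$. The entry $\pi_i$ is a left-to-right minimum if $\pi_j>\pi_i$ for all $j<i$, and a right-to-left maximum if $\pi_j<\pi_i$ for all $j>i$. For $\pi\in \mathrm{Av}_n(123)$, the *boundary grid* of $\pi$ is the set of boxes $(x,y)$, $1\le x,y\le n-1$, where $(x,y)$ denotes the unit square with lower-left vertex $(x,y)$ and upper-right vertex $(x+1,y+1)$, such that there are a left-to-right minimum $\pi_i$ with $i\le x$, $\pi_i\le y$ and a right-to-left maximum $\pi_k$ with $x+1\le k$, $y+1\le \pi_k$. The *downcore graph* of a set $D$ of boxes has the boxes of $D$ as its vertices, with $(i,j)$ and $(k,\ell)$ adjacent if and only if ($i<k$ and $j>\ell$, or $i>k$ and $j<\ell$)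 and both $(i,\ell)$ and $(k,j)$ belong to $D$. A finite graph is *pure* if all of its inclusion-maximal independent sets have the same size. Then: 1. For every $n\ge 0$ and every $\pi\in \mathrm{Av}_n(123)$, the downcore graph of the boundary grid of $\pi$ is pure if and only if $\pi$ avoids $2143$. 2. For every $n\ge 1$, the number of permutations $\pi\in \mathrm{Av}_n(123)$ such that the downcore graph of the boundary grid of $\pi$ is pure equals the Fibonacci number $F_{2n-1}$, where $F_1=F_2=1$ and $F_{m+2}=F_{m+1}+F_m$. -/

import Mathlib

/-- Two sequences of the same length are order-isomorphic. -/
def OrderIsomorphic {k : ℕ} {α β : Type*} [LT α] [LT β] (a : Fin k → α) (b : Fin k → β) : Prop :=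
  ∀ i j : Fin k, a i < a j ↔ b i < b j

/-- The permutation `π` contains `σ` as a classical pattern. Permutations of `{1, …, n}` are
modelled on `Fin n = {0, …, n - 1}`: the entry `π_{i+1}` is `(π i : ℕ) + 1`. -/
def ContainsPattern {n k : ℕ} (π : Equiv.Perm (Fin n)) (σ : Equiv.Perm (Fin k)) : Prop :=
  ∃ f : Fin k → Fin n, StrictMono f ∧ OrderIsomorphic (fun j => π (f j)) (fun j => σ j)

/-- The permutation `π` avoids the classical pattern `σ`. -/
def AvoidsPattern {n k : ℕ} (π : Equiv.Perm (Fin n)) (σ : Equiv.Perm (Fin k)) : Prop :=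
  ¬ ContainsPattern π σ

/-- `Av_n(σ)`: the permutations of length `n` that avoid `σ`. -/
def Av (n : ℕ) {k : ℕ} (σ : Equiv.Perm (Fin k)) : Set (Equiv.Perm (Fin n)) :=
  {π | AvoidsPattern π σ}

/-- The pattern `123`, the identity. -/
def pattern123 : Equiv.Perm (Fin 3) := 1

/-- The pattern `2143`: swap the first two entries and the last two entries. -/
def pattern2143 : Equiv.Perm (Fin 4) := Equiv.swap 0 1 * Equiv.swap 2 3

/-- The entry of `π` at position `i` is a left-to-right minimum. -/
def IsLeftToRightMin {n : ℕ} (π : Equiv.Perm (Fin n)) (i : Fin n) : Prop :=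
  ∀ j : Fin n, j < i → π i < π j

/-- The entry of `π` at position `i` is a right-to-left maximum. -/
def IsRightToLeftMax {n : ℕ} (π : Equiv.Perm (Fin n)) (i : Fin n) : Prop :=
  ∀ j : Fin n, i < j → π j < π i

/-- The boundary grid of `π`, a set of boxes of the `(n - 1) × (n - 1)` grid whose vertices are
the lattice points from `(1, 1)` to `(n, n)`. The box `(x, y)`, in column `x` from the left and row
`y` from the bottom, has lower left vertex `(x, y)` and upper right vertex `(x + 1, y + 1)`; the
entry of `π` at index `i : Fin n` is the lattice point `(i + 1, π i + 1)`. A box belongs to the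
boundary grid if it is above and to the right of some left-to-right minimum, and below and to the
left of some right-to-left maximum. -/
def boundaryGrid {n : ℕ} (π : Equiv.Perm (Fin n)) : Set (ℕ × ℕ) :=
  {b | b.1 ∈ Set.Icc 1 (n - 1) ∧ b.2 ∈ Set.Icc 1 (n - 1) ∧
    (∃ i : Fin n, IsLeftToRightMin π i ∧ (i : ℕ) + 1 ≤ b.1 ∧ (π i : ℕ) + 1 ≤ b.2) ∧
    (∃ i : Fin n, IsRightToLeftMax π i ∧ b.1 + 1 ≤ (i : ℕ) + 1 ∧ b.2 + 1 ≤ (π i : ℕ) + 1)}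

/-- The downcore graph of a set `D` of boxes: its vertices are the boxes of `D`, and the boxes
`(i, j)` and `(k, l)` are adjacent if `i < k, j > l` or `i > k, j < l`, and both `(i, l)` and
`(k, j)` are in `D`. -/
def downcoreGraph (D : Set (ℕ × ℕ)) : SimpleGraph D where
  Adj b c :=
    ((b.1.1 < c.1.1 ∧ b.1.2 > c.1.2) ∨ (b.1.1 > c.1.1 ∧ b.1.2 < c.1.2)) ∧
      (b.1.1, c.1.2) ∈ D ∧ (c.1.1, b.1.2) ∈ D
  symm := ⟨fun _ _ h => ⟨h.1.symm.imp id id, h.2.2, h.2.1⟩⟩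
  loopless := ⟨fun _ h => by rcases h.1 with h | h <;> exact absurd h.1 (lt_irrefl _)⟩

/-- A graph is pure if all its (inclusion-)maximal independent sets have the same size. -/
def IsPureGraph {V : Type*} (G : SimpleGraph V) : Prop :=
  ∀ s t : Set V, Maximal G.IsIndepSet s → Maximal G.IsIndepSet t → s.encard = t.encard

/-! Give the box `(i, j)` the vector `e_i + f_j`, with separate basis vectors for columns and rows.
For adjacent boxes, the two boxes and their two other corners satisfy one linear relation. In an
order-convex finite set of boxes this relation lets every maximal independent set span all box
vectors (`boxVector_mem_span`). If independent sets are also linearly independent, each maximal one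
has size the rank of that span, so the graph is pure. A linear dependence in an independent set
forces two missing corners (`exists_missing_corners`), and in a boundary grid these produce a
`2143`.

Conversely, a `2143` in a `123`-avoider can be normalised (`exists_extremal_occurrence`) so that
some maximal independent set admits an exchange of one box for two, which destroys purity.

For the count, removing the first entry, or a maximum in second position, gives `a (n+2) + a n = 3 *
a (n+1)`, the recurrence of the odd-indexed Fibonacci numbers. -/

/-! ### Pattern avoidance in terms of entries. -/

theorem avoidsPattern_pattern123_iff {n : ℕ} (π : Equiv.Perm (Fin n)) :
    AvoidsPattern π pattern123 ↔
      ∀ i j k : Fin n, i < j → j < k → π i < π j → π j < π k → False := by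
  constructor
  · intro h i j k hij hjk h₁ h₂
    refine h ⟨![i, j, k], ?_, ?_⟩
    · refine Fin.strictMono_iff_lt_succ.2 fun x => ?_
      fin_cases x
      · simpa using hij
      · simpa using hjk
    · intro x y
      have h₃ := h₁.trans h₂
      fin_cases x <;> fin_cases y <;>
        simp [pattern123, h₁, h₂, h₃, h₁.le, h₂.le, h₃.le]
  · rintro h ⟨f, hf, ho⟩
    exact h (f 0) (f 1) (f 2) (hf (by decide)) (hf (by decide))
      ((ho 0 1).2 (by simp [pattern123])) ((ho 1 2).2 (by simp [pattern123]))

theorem avoidsPattern_pattern2143_iff {n : ℕ} (π : Equiv.Perm (Fin n)) :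
    AvoidsPattern π pattern2143 ↔
      ∀ a b c d : Fin n, a < b → b < c → c < d →
        π b < π a → π a < π d → π d < π c → False := by
  have e0 : pattern2143 0 = 1 := by decide
  have e1 : pattern2143 1 = 0 := by decide
  have e2 : pattern2143 2 = 3 := by decide
  have e3 : pattern2143 3 = 2 := by decide
  constructor
  · intro h a b c d hab hbc hcd h₁ h₂ h₃
    refine h ⟨![a, b, c, d], ?_, ?_⟩
    · refine Fin.strictMono_iff_lt_succ.2 fun x => ?_
      fin_cases x
      · simpa using hab
      · simpa using hbc
      · simpa using hcd
    · intro x y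
      have h₄ := h₁.trans h₂
      have h₅ := h₂.trans h₃
      have h₆ := h₁.trans h₅
      fin_cases x <;> fin_cases y <;>
        simp [e0, e1, e2, e3, h₁, h₂, h₃, h₄, h₅, h₆, h₁.le, h₂.le, h₃.le, h₄.le, h₅.le, h₆.le]
  · rintro h ⟨f, hf, ho⟩
    exact h (f 0) (f 1) (f 2) (f 3) (hf (by decide)) (hf (by decide)) (hf (by decide))
      ((ho 1 0).2 (by simp [e0, e1])) ((ho 0 3).2 (by simp [e0, e3]))
      ((ho 3 2).2 (by simp [e2, e3]))

/-! ### Maximal independent sets span all box vectors. -/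

/-- The sum of the basis vectors of the column and of the row of a box. -/
noncomputable def boxVector (b : ℕ × ℕ) : ℕ ⊕ ℕ →₀ ℚ :=
  Finsupp.single (Sum.inl b.1) 1 + Finsupp.single (Sum.inr b.2) 1

theorem boxVector_add_boxVector (i j k l : ℕ) :
    boxVector (i, j) + boxVector (k, l) = boxVector (i, l) + boxVector (k, j) := by
  simp only [boxVector]
  abel

theorem mem_of_mem_Icc {D : Set (ℕ × ℕ)} (hD : D.OrdConnected) {a b x y x' y' : ℕ}
    (h : (x, y) ∈ D) (h' : (x', y') ∈ D) (hx : x ≤ a) (hy : y ≤ b) (hx' : a ≤ x') (hy' : b ≤ y') :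
    (a, b) ∈ D :=
  hD.out h h' ⟨⟨hx, hy⟩, ⟨hx', hy'⟩⟩

/-- If `(x, y)` lay too far out for the conclusion, convexity of `P` would supply the corners that
make it cross `(k, l)`, against `hn`. An abstract `P` allows reuse with the coordinates transposed.
-/
theorem crossing_of_crossing_corner {P : ℕ → ℕ → Prop}
    (hP : ∀ {x y x' y'} (a b : ℕ), P x y → P x' y' → x ≤ a → y ≤ b → a ≤ x' → b ≤ y' → P a b)
    {i j k l x y p q : ℕ} (hik : i < k) (hlj : l < j) (hij : P i j) (hil : P i l) (hkj : P k j)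
    (hn : (k < x ∧ l > y) ∨ (k > x ∧ l < y) → P k y → P x l → False)
    (hpq : (p = i ∧ q = l) ∨ (p = k ∧ q = j))
    (hc : (p < x ∧ q > y) ∨ (p > x ∧ q < y)) (hpy : P p y) (hxq : P x q) :
    ((i < x ∧ j > y) ∨ (i > x ∧ j < y)) ∧ P i y ∧ P x j := by
  rcases hpq with ⟨rfl, rfl⟩ | ⟨rfl, rfl⟩ <;> rcases hc with ⟨h1, h2⟩ | ⟨h1, h2⟩
  · have hxk : x ≤ k := by
      by_contra! h
      exact hn (Or.inl ⟨h, h2⟩) (hP k y hpy hkj hik.le le_rfl le_rfl (by lia)) hxq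
    exact ⟨Or.inl ⟨h1, by lia⟩, hpy, hP x j hij hkj h1.le le_rfl hxk le_rfl⟩
  · have hjy : j < y := by
      by_contra! h
      exact hn (Or.inr ⟨by lia, h2⟩)
        (hP k y hpy hkj hik.le le_rfl le_rfl h) hxq
    exact ⟨Or.inr ⟨h1, hjy⟩, hpy, hP x j hxq hij le_rfl hlj.le h1.le le_rfl⟩
  · have hly : l ≤ y := by
      by_contra! h
      exact hn (Or.inl ⟨h1, h⟩) hpy (hP x l hil hxq (by lia) le_rfl le_rfl hlj.le)
    exact ⟨Or.inl ⟨by lia, h2⟩, hP i y hil hij le_rfl hly le_rfl h2.le, hxq⟩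
  · have hxi : x < i := by
      by_contra! h
      exact hn (Or.inr ⟨h1, by lia⟩) hpy (hP x l hil hkj h le_rfl h1.le hlj.le)
    exact ⟨Or.inr ⟨hxi, h2⟩, hP i y hij hpy le_rfl h2.le hik.le le_rfl, hxq⟩

/-- Let `b`, `c` be adjacent with `b` to the upper left of `c`. If `c` lies in an independent set
`s`, then every neighbour in `s` of the lower left or upper right corner is a neighbour of `b`. -/
theorem adj_of_adj_corner {D : Set (ℕ × ℕ)} (hD : D.OrdConnected) {s : Set D}
    (hs : (downcoreGraph D).IsIndepSet s) {b c e f : D} (hc : c ∈ s)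
    (hbc : (downcoreGraph D).Adj b c) (he : e ∈ s)
    (hf : f.1 = (b.1.1, c.1.2) ∨ f.1 = (c.1.1, b.1.2)) (hfe : (downcoreGraph D).Adj f e) :
    (downcoreGraph D).Adj b e := by
  obtain ⟨⟨i, j⟩, hb⟩ := b
  obtain ⟨⟨k, l⟩, hc'⟩ := c
  obtain ⟨⟨x, y⟩, he'⟩ := e
  obtain ⟨⟨p, q⟩, hf'⟩ := f
  have hn : ¬ (downcoreGraph D).Adj ⟨(k, l), hc'⟩ ⟨(x, y), he'⟩ := fun h => hs hc he h.ne h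
  have hn' : (k < x ∧ l > y) ∨ (k > x ∧ l < y) → (k, y) ∈ D → (x, l) ∈ D → False :=
    fun h h' h'' => hn ⟨h, h', h''⟩
  obtain ⟨hbc, hil, hkj⟩ := hbc
  obtain ⟨hfe, hpy, hxq⟩ := hfe
  simp only [Prod.mk.injEq] at *
  rcases hbc with ⟨hik, hlj⟩ | ⟨hki, hjl⟩
  · exact crossing_of_crossing_corner (P := fun a b => (a, b) ∈ D)
      (fun _ _ => mem_of_mem_Icc hD) hik hlj hb hil hkj hn' hf hfe hpy hxq
  -- Reflection in the diagonal reduces `b` to the lower right of `c` to the previous case.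
  · obtain ⟨h1, h2, h3⟩ := crossing_of_crossing_corner (P := fun a b => (b, a) ∈ D)
      (i := j) (j := i) (k := l) (l := k) (x := y) (y := x) (p := q) (q := p)
      (fun _ _ h h' h1 h2 h3 h4 => mem_of_mem_Icc hD h h' h2 h1 h4 h3) hjl hki hb hkj hil
      (fun h h' h'' => hn' (by lia) h'' h') (by lia) (by lia) hxq hpy
    exact ⟨by lia, h3, h2⟩

theorem exists_adj_of_maximal {V : Type*} {G : SimpleGraph V} {s : Set V}
    (hs : Maximal G.IsIndepSet s) {b : V} (hb : b ∉ s) : ∃ c ∈ s, G.Adj b c := by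
  by_contra! h
  refine hb (hs.2 (y := insert b s) ?_ (Set.subset_insert b s) (Set.mem_insert b s))
  exact Set.Pairwise.insert hs.1 fun c hc _ => ⟨h c hc, fun h' => h c hc h'.symm⟩

/-- The box vectors of a maximal independent set span all box vectors. -/
theorem boxVector_mem_span {D : Set (ℕ × ℕ)} (hD : D.OrdConnected) (hfin : D.Finite) {s : Set D}
    (hs : Maximal (downcoreGraph D).IsIndepSet s) (b : D) :
    boxVector b ∈ Submodule.span ℚ ((fun d : D => boxVector d) '' s) := by
  -- Induction on the number of neighbours of `b` in `s`. The two corners spanned by `b` and a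
  -- neighbour `c` have fewer: their neighbours in `s` are neighbours of `b`, while `c` shares a row
  -- or column with each corner and drops out.
  have : Finite D := hfin
  induction h : {c ∈ s | (downcoreGraph D).Adj b c}.ncard using Nat.strong_induction_on
    generalizing b with
  | _ m ih =>
    by_cases hb : b ∈ s
    · exact Submodule.subset_span ⟨b, hb, rfl⟩
    obtain ⟨c, hc, hbc⟩ := exists_adj_of_maximal hs hb
    have key : ∀ f : D, f.1 = (b.1.1, c.1.2) ∨ f.1 = (c.1.1, b.1.2) →
        boxVector f ∈ Submodule.span ℚ ((fun d : D => boxVector d) '' s) := by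
      intro f hf
      refine ih _ ?_ f rfl
      rw [← h]
      refine Set.ncard_lt_ncard ⟨fun e he => ⟨he.1, ?_⟩, fun hsub => ?_⟩ (Set.toFinite _)
      · exact adj_of_adj_corner hD hs.1 hc hbc he.1 hf he.2
      · obtain ⟨_, hadj, -⟩ := hsub ⟨hc, hbc⟩
        rcases hf with hf | hf <;> rw [hf] at hadj <;> simp at hadj
    have h1 := key ⟨_, hbc.2.1⟩ (Or.inl rfl)
    have h2 := key ⟨_, hbc.2.2⟩ (Or.inr rfl)
    have h3 : boxVector c ∈ Submodule.span ℚ ((fun d : D => boxVector d) '' s) :=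
      Submodule.subset_span ⟨c, hc, rfl⟩
    have h4 := boxVector_add_boxVector b.1.1 b.1.2 c.1.1 c.1.2
    rw [eq_sub_of_add_eq h4]
    exact sub_mem (add_mem h1 h2) h3

theorem span_boxVector_image {D : Set (ℕ × ℕ)} (hD : D.OrdConnected) (hfin : D.Finite) {s : Set D}
    (hs : Maximal (downcoreGraph D).IsIndepSet s) :
    Submodule.span ℚ ((fun d : D => boxVector d) '' s) =
      Submodule.span ℚ (Set.range fun d : D => boxVector d) := by
  refine le_antisymm (Submodule.span_mono (Set.image_subset_range _ _)) (Submodule.span_le.2 ?_)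
  rintro _ ⟨b, rfl⟩
  exact boxVector_mem_span hD hfin hs b

/-! ### Linear dependence among the boxes of an independent set. -/

/-- A nontrivial linear relation among box vectors involves at least two boxes in each column
that it meets, and likewise for rows. -/
theorem exists_ne_of_linearCombination_eq_zero {D : Set (ℕ × ℕ)} {l : D →₀ ℚ}
    (hl : Finsupp.linearCombination ℚ (fun d : D => boxVector d) l = 0) {b : D}
    (hb : b ∈ l.support) :
    (∃ c ∈ l.support, c.1.1 = b.1.1 ∧ c.1.2 ≠ b.1.2) ∧
      (∃ c ∈ l.support, c.1.2 = b.1.2 ∧ c.1.1 ≠ b.1.1) := by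
  have key : ∀ t : ℕ ⊕ ℕ, boxVector b t = 1 → ∃ c ∈ l.support, c ≠ b ∧ boxVector c t ≠ 0 := by
    intro t ht
    by_contra! h
    have h0 := DFunLike.congr_fun hl t
    rw [Finsupp.linearCombination_apply, Finsupp.sum, Finsupp.finsetSum_apply,
      Finset.sum_eq_single_of_mem b hb] at h0
    · simp [ht] at h0
      simp [h0] at hb
    · intro c hc hcb
      simp [h c hc hcb]
  constructor
  · obtain ⟨c, hc, hcb, h⟩ := key (Sum.inl b.1.1) (by simp [boxVector])
    have h' : c.1.1 = b.1.1 := by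
      by_contra h'
      simp [boxVector, h'] at h
    exact ⟨c, hc, h', fun h2 => hcb (Subtype.ext (Prod.ext h' h2))⟩
  · obtain ⟨c, hc, hcb, h⟩ := key (Sum.inr b.1.2) (by simp [boxVector])
    have h' : c.1.2 = b.1.2 := by
      by_contra h'
      simp [boxVector, h'] at h
    exact ⟨c, hc, h', fun h2 => hcb (Subtype.ext (Prod.ext h2 h'))⟩

/-- If the box vectors of an independent set are linearly dependent, then the set of boxes has a
missing lower left corner and a missing upper right corner of the following relative position. -/
theorem exists_missing_corners {D : Set (ℕ × ℕ)} (hD : D.OrdConnected) {s : Set D}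
    (hs : (downcoreGraph D).IsIndepSet s)
    (hdep : ¬ LinearIndepOn ℚ (fun d : D => boxVector d) s) :
    ∃ x₀ y₀ x₁ y₁ X r a c : ℕ, (x₀, y₀) ∈ D ∧ (x₁, y₀) ∈ D ∧ (x₀, y₁) ∈ D ∧ (x₁, y₁) ∉ D ∧
      (X, r) ∈ D ∧ (a, r) ∈ D ∧ (X, c) ∈ D ∧ (a, c) ∉ D ∧
      x₀ < x₁ ∧ y₀ < y₁ ∧ a < X ∧ c < r ∧ x₀ ≤ a ∧ y₁ ≤ r ∧ c < y₀ ∧ X < x₁ := by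
  rw [linearIndepOn_iff] at hdep
  push Not at hdep
  obtain ⟨l, hls, hl, hl0⟩ := hdep
  have hls' : ∀ d ∈ l.support, d ∈ s := fun d hd => hls hd
  have hne : l.support.Nonempty := Finsupp.support_nonempty_iff.2 hl0
  -- `m` is the lowest box of the leftmost column of the support, `M` the rightmost box of its top
  -- row. Partners of `m` in its column and row therefore lie above and to the right, those of `M`
  -- below and to the left.
  obtain ⟨m, hm, hmmin⟩ := l.support.exists_min_image (fun d => toLex (d.1.1, d.1.2)) hne
  obtain ⟨M, hM, hMmax⟩ := l.support.exists_max_image (fun d => toLex (d.1.2, d.1.1)) hne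
  simp only [Prod.Lex.toLex_le_toLex] at hmmin hMmax
  obtain ⟨⟨u, hu, hu1, hu2⟩, ⟨v, hv, hv1, hv2⟩⟩ := exists_ne_of_linearCombination_eq_zero hl hm
  obtain ⟨⟨w, hw, hw1, hw2⟩, ⟨z, hz, hz1, hz2⟩⟩ := exists_ne_of_linearCombination_eq_zero hl hM
  have hmu := hmmin u hu
  have hmv := hmmin v hv
  have hmz := hmmin z hz
  have hMw := hMmax w hw
  have hMz := hMmax z hz
  have hMu := hMmax u hu
  have hind : ∀ d ∈ l.support, ∀ e ∈ l.support, ¬ (downcoreGraph D).Adj d e :=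
    fun d hd e he h => hs (hls' d hd) (hls' e he) h.ne h
  have h1 := hind u hu v hv
  have h2 := hind z hz w hw
  obtain ⟨⟨x₀, y₀⟩, hm'⟩ := m
  obtain ⟨⟨X, r⟩, hM'⟩ := M
  obtain ⟨⟨x₀', y₁⟩, hu'⟩ := u
  obtain ⟨⟨x₁, y₀'⟩, hv'⟩ := v
  obtain ⟨⟨X', c⟩, hw'⟩ := w
  obtain ⟨⟨a, r'⟩, hz'⟩ := z
  simp only at *
  subst hu1 hv1 hw1 hz1
  -- The two partners are not adjacent although one of their corners, `m` or `M`, is in `D`; hence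
  -- the opposite corner is missing.
  have g1 : (x₁, y₁) ∉ D := fun h => h1 ⟨by simp only; lia, hm', h⟩
  have g2 : (a, c) ∉ D := fun h => h2 ⟨by simp only; lia, h, hM'⟩
  have conv := @mem_of_mem_Icc D hD
  refine ⟨x₀', y₀', x₁, y₁, X', r', a, c, hm', hv', hu', g1, hM', hz', hw', g2, by lia, by lia,
    by lia, by lia, by lia, by lia, ?_, ?_⟩
  · by_contra! h
    exact g2 (conv hm' hz' (by lia) h le_rfl (by lia))
  · by_contra! h
    exact g1 (conv hv' hM' le_rfl (by lia) h (by lia))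

/-! ### Boundary grids, and purity for `2143`-avoiders. -/

/-- The extremality conditions are free: the least entry at positions up to `i` is a left-to-right
minimum lying weakly below and left of the entry at `i`, and dually for maxima. The bounds on `x`
and `y` follow from the witnesses. -/
theorem mem_boundaryGrid_iff {n : ℕ} (π : Equiv.Perm (Fin n)) (x y : ℕ) :
    (x, y) ∈ boundaryGrid π ↔
      (∃ i : Fin n, (i : ℕ) + 1 ≤ x ∧ (π i : ℕ) + 1 ≤ y) ∧
        (∃ k : Fin n, x ≤ (k : ℕ) ∧ y ≤ (π k : ℕ)) := by
  constructor
  · rintro ⟨-, -, ⟨i, -, hi⟩, ⟨k, -, hk⟩⟩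
    exact ⟨⟨i, hi⟩, ⟨k, by simpa using hk⟩⟩
  · rintro ⟨⟨i, hi1, hi2⟩, ⟨k, hk1, hk2⟩⟩
    obtain ⟨i', hi', hmin⟩ := (Finset.Iic i).exists_min_image π ⟨i, by simp⟩
    obtain ⟨k', hk', hmax⟩ := (Finset.Ici k).exists_max_image π ⟨k, by simp⟩
    simp only [Finset.mem_Iic, Finset.mem_Ici] at hi' hk' hmin hmax
    have hi := hmin i le_rfl
    have hk := hmax k le_rfl
    refine ⟨⟨by lia, ?_⟩, ⟨by lia, ?_⟩, ⟨i', fun j hj => ?_, ?_, ?_⟩, ⟨k', fun j hj => ?_, ?_, ?_⟩⟩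
    · simp only; lia
    · simp only; lia
    · exact lt_of_le_of_ne (hmin j (hj.le.trans hi')) fun h => hj.ne (π.injective h).symm
    · simp only; lia
    · simp only; lia
    · exact lt_of_le_of_ne (hmax j (hk'.trans hj.le)) fun h => hj.ne (π.injective h).symm
    · simp only; lia
    · simp only; lia

theorem ordConnected_boundaryGrid {n : ℕ} (π : Equiv.Perm (Fin n)) :
    (boundaryGrid π).OrdConnected := by
  refine ⟨?_⟩
  rintro ⟨x, y⟩ hx ⟨x', y'⟩ hx' ⟨a, b⟩ ⟨⟨h1, h2⟩, ⟨h3, h4⟩⟩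
  rw [mem_boundaryGrid_iff] at *
  obtain ⟨⟨i, hi1, hi2⟩, -⟩ := hx
  obtain ⟨-, ⟨k, hk1, hk2⟩⟩ := hx'
  simp only at h1 h2 h3 h4
  exact ⟨⟨i, by lia, by lia⟩, ⟨k, by lia, by lia⟩⟩

theorem finite_boundaryGrid {n : ℕ} (π : Equiv.Perm (Fin n)) : (boundaryGrid π).Finite :=
  ((Set.finite_Icc 1 (n - 1)).prod (Set.finite_Icc 1 (n - 1))).subset fun _ hb => ⟨hb.1, hb.2.1⟩

/-- Entries `p`, `q` below and left of the boxes `(x₀, y₀)`, `(X, c)`, and `w`, `t` above and right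
of `(X, r)`, `(x₁, y₀)`, form a `2143` in the order `p q w t`; the missing corners separate `p` from
`q` and `w` from `t`. -/
theorem linearIndepOn_boxVector_of_avoidsPattern {n : ℕ} {π : Equiv.Perm (Fin n)}
    (hπ : AvoidsPattern π pattern2143) {s : Set (boundaryGrid π)}
    (hs : (downcoreGraph (boundaryGrid π)).IsIndepSet s) :
    LinearIndepOn ℚ (fun d : boundaryGrid π => boxVector d) s := by
  by_contra hdep
  obtain ⟨x₀, y₀, x₁, y₁, X, r, a, c, h1, h2, h3, h4, h5, h6, h7, h8, k1, k2, k3, k4,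
      k5, k6, k7, k8⟩ :=
    exists_missing_corners (ordConnected_boundaryGrid π) hs hdep
  simp only [mem_boundaryGrid_iff, not_and_or] at h1 h2 h3 h4 h5 h6 h7 h8
  obtain ⟨⟨p, hp1, hp2⟩, -⟩ := h1
  obtain ⟨⟨q, hq1, hq2⟩, -⟩ := h7
  obtain ⟨-, ⟨t, ht1, ht2⟩⟩ := h2
  obtain ⟨-, ⟨w, hw1, hw2⟩⟩ := h5
  have h4' : ∀ k : Fin n, x₁ ≤ (k : ℕ) → (π k : ℕ) < y₁ := by
    intro k hk
    by_contra! hk'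
    rcases h4 with h4 | h4
    · exact h4 ⟨p, by lia, by lia⟩
    · exact h4 ⟨k, hk, hk'⟩
  have h8' : ∀ i : Fin n, (i : ℕ) + 1 ≤ a → c < (π i : ℕ) + 1 := by
    intro i hi
    by_contra! hi'
    rcases h8 with h8 | h8
    · exact h8 ⟨i, hi, hi'⟩
    · exact h8 ⟨w, by lia, by lia⟩
  have e1 := h8' p (by lia)
  have e2 : ¬ (q : ℕ) + 1 ≤ a := fun h => by have := h8' q h; lia
  have e3 := h4' t ht1
  have e4 : ¬ x₁ ≤ (w : ℕ) := fun h => by have := h4' w h; lia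
  exact (avoidsPattern_pattern2143_iff π).1 hπ p q w t (by lia) (by lia) (by lia) (by lia)
    (by lia) (by lia)

theorem isPureGraph_of_avoidsPattern {n : ℕ} {π : Equiv.Perm (Fin n)}
    (hπ : AvoidsPattern π pattern2143) : IsPureGraph (downcoreGraph (boundaryGrid π)) := by
  intro s t hs ht
  rw [← toENat_rank_span_set (linearIndepOn_boxVector_of_avoidsPattern hπ hs.1),
    ← toENat_rank_span_set (linearIndepOn_boxVector_of_avoidsPattern hπ ht.1),
    span_boxVector_image (ordConnected_boundaryGrid π) (finite_boundaryGrid π) hs,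
    span_boxVector_image (ordConnected_boundaryGrid π) (finite_boundaryGrid π) ht]

/-! ### Failure of purity when `2143` occurs. -/

/-- If one vertex of a maximal independent set can be exchanged for two, the graph is not pure. -/
theorem not_isPureGraph_of_exchange {V : Type*} [Finite V] {G : SimpleGraph V} {K : Set V}
    (hK : Maximal G.IsIndepSet K) {m u v : V} (hm : m ∈ K) (huv : u ≠ v) (huv' : ¬ G.Adj u v)
    (hum : G.Adj u m) (hvm : G.Adj v m) (hu : ∀ w ∈ K, G.Adj u w → w = m)
    (hv : ∀ w ∈ K, G.Adj v w → w = m) : ¬ IsPureGraph G := by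
  intro hpure
  have huK : u ∉ K := fun h => hK.1 h hm hum.ne hum
  have hvK : v ∉ K := fun h => hK.1 h hm hvm.ne hvm
  have hT : G.IsIndepSet (insert u (insert v (K \ {m}))) := by
    refine Set.Pairwise.insert (Set.Pairwise.insert (hK.1.mono Set.sdiff_subset) ?_) ?_
    · intro w hw _
      exact ⟨fun h => hw.2 (hv w hw.1 h), fun h => hw.2 (hv w hw.1 h.symm)⟩
    · rintro w (rfl | hw) _
      · exact ⟨huv', fun h => huv' h.symm⟩
      · exact ⟨fun h => hw.2 (hu w hw.1 h), fun h => hw.2 (hu w hw.1 h.symm)⟩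
  obtain ⟨T, hle, hTmax⟩ := Finite.exists_le_maximal hT
  have h1 := Set.encard_le_encard (show _ ⊆ T from hle)
  rw [← hpure K T hK hTmax, Set.encard_insert_of_notMem (by simp [huv, huK]),
    Set.encard_insert_of_notMem (by simp [hvK]), Set.encard_sdiff_singleton_add_one hm] at h1
  exact absurd h1 (not_le.2 (ENat.lt_add_one_iff (Set.toFinite K).encard_lt_top.ne |>.2 le_rfl))

/-- In a `123`-avoiding permutation, an occurrence of `2143` can be chosen with its two middle
entries adjacent, its first entry minimal before them and its last entry maximal after them. -/
theorem exists_extremal_occurrence {n : ℕ} {π : Equiv.Perm (Fin n)}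
    (h123 : AvoidsPattern π pattern123) (h : ContainsPattern π pattern2143) :
    ∃ a b c d : Fin n, a < b ∧ (c : ℕ) = b + 1 ∧ c < d ∧ π b < π a ∧ π a < π d ∧ π d < π c ∧
      (∀ j < b, π a ≤ π j) ∧ (∀ j, c < j → π j ≤ π d) := by
  rw [avoidsPattern_pattern123_iff] at h123
  have h' : ∃ a b c d : Fin n, a < b ∧ b < c ∧ c < d ∧ π b < π a ∧ π a < π d ∧ π d < π c := by
    by_contra hno
    refine (avoidsPattern_pattern2143_iff π).2 (fun a b c d h1 h2 h3 h4 h5 h6 => ?_) h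
    exact hno ⟨a, b, c, d, h1, h2, h3, h4, h5, h6⟩
  obtain ⟨a₀, b₀, c₀, d₀, h1, h2, h3, h4, h5, h6⟩ := h'
  -- `b` is the last position before `c₀` with value below `π a₀`. The next entry must exceed `π
  -- d₀`, since otherwise it would be `c₀` or the middle of a `123` from `b` to `c₀`.
  obtain ⟨b, hb, hbmax⟩ := (Finset.univ.filter fun j => b₀ ≤ j ∧ j < c₀ ∧ π j < π a₀).exists_max_image
    id ⟨b₀, by simp [h2, h4]⟩
  simp only [Finset.mem_filter, Finset.mem_univ, true_and, id] at hb hbmax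
  obtain ⟨hb1, hb2, hb3⟩ := hb
  obtain ⟨c, hc⟩ : ∃ c : Fin n, (c : ℕ) = b + 1 := ⟨⟨b + 1, by lia⟩, rfl⟩
  have hc1 : π d₀ < π c := by
    rcases eq_or_ne c c₀ with rfl | hne
    · exact h6
    by_contra! hle
    have hac : ¬ π c < π a₀ := fun hlt => by
      have := hbmax c ⟨by lia, by lia, hlt⟩
      lia
    exact h123 b c c₀ (by lia) (by lia) (by lia) (by lia)
  obtain ⟨a, ha, hamin⟩ := (Finset.Iio b).exists_min_image π ⟨a₀, by simp; lia⟩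
  obtain ⟨d, hd, hdmax⟩ := (Finset.Ioi c).exists_max_image π ⟨d₀, by simp; lia⟩
  simp only [Finset.mem_Iio, Finset.mem_Ioi] at ha hamin hd hdmax
  have ha1 := hamin a₀ (by lia)
  have hd1 := hdmax d₀ (by lia)
  refine ⟨a, b, c, d, ha, hc, hd, ?_, by lia, ?_, hamin, hdmax⟩
  · by_contra! hle
    have hne : π a ≠ π b := fun h => ha.ne (π.injective h)
    exact h123 a b c ha (by lia) (by lia) (by lia)
  · by_contra! hle
    have hne : π c ≠ π d := fun h => hd.ne (π.injective h)
    exact h123 b c d (by lia) hd (by lia) (by lia)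

/-- The exchanged box is `m = (b + 1, π d)`, in the column between the two middle entries, and it is
replaced by `u = (b, π d + 1)` and `v = (b + 2, π a)`. These are not adjacent because the corner
`(b, π a)` is missing, by minimality of `π a`. Including `g = (b, π d)` and `h = (b + 1, π a)` in
the maximal set excludes all other neighbours of `u` and `v`. -/
theorem not_isPureGraph_of_containsPattern {n : ℕ} {π : Equiv.Perm (Fin n)}
    (h123 : AvoidsPattern π pattern123) (h : ContainsPattern π pattern2143) :
    ¬ IsPureGraph (downcoreGraph (boundaryGrid π)) := by
  obtain ⟨a, b, c, d, hab, hbc, hcd, h1, h2, h3, hmin, hmax⟩ := exists_extremal_occurrence h123 h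
  have : Finite (boundaryGrid π) := finite_boundaryGrid π
  have mem : ∀ (x y : ℕ) (i k : Fin n), (i : ℕ) + 1 ≤ x → (π i : ℕ) + 1 ≤ y → x ≤ (k : ℕ) →
      y ≤ (π k : ℕ) → (x, y) ∈ boundaryGrid π := fun x y i k e1 e2 e3 e4 =>
    (mem_boundaryGrid_iff π x y).2 ⟨⟨i, e1, e2⟩, ⟨k, e3, e4⟩⟩
  have low : ∀ x y : ℕ, (x, y) ∈ boundaryGrid π → x ≤ b → (π a : ℕ) + 1 ≤ y := by
    intro x y hxy hx
    obtain ⟨⟨i, hi1, hi2⟩, -⟩ := (mem_boundaryGrid_iff π x y).1 hxy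
    have := hmin i (by lia)
    lia
  have high : ∀ x y : ℕ, (x, y) ∈ boundaryGrid π → (b : ℕ) + 2 ≤ x → y ≤ (π d : ℕ) := by
    intro x y hxy hx
    obtain ⟨-, ⟨k, hk1, hk2⟩⟩ := (mem_boundaryGrid_iff π x y).1 hxy
    have := hmax k (by lia)
    lia
  have hm : ((b : ℕ) + 1, (π d : ℕ)) ∈ boundaryGrid π :=
    mem _ _ b c (by lia) (by lia) (by lia) (by lia)
  have hg : ((b : ℕ), (π d : ℕ)) ∈ boundaryGrid π :=
    mem _ _ a c (by lia) (by lia) (by lia) (by lia)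
  have hh : ((b : ℕ) + 1, (π a : ℕ)) ∈ boundaryGrid π :=
    mem _ _ b c (by lia) (by lia) (by lia) (by lia)
  have hu : ((b : ℕ), (π d : ℕ) + 1) ∈ boundaryGrid π :=
    mem _ _ a c (by lia) (by lia) (by lia) (by lia)
  have hv : ((b : ℕ) + 2, (π a : ℕ)) ∈ boundaryGrid π :=
    mem _ _ b d (by lia) (by lia) (by lia) (by lia)
  have hum : ((b : ℕ) + 1, (π d : ℕ) + 1) ∈ boundaryGrid π :=
    mem _ _ b c (by lia) (by lia) (by lia) (by lia)
  have hvm : ((b : ℕ) + 2, (π d : ℕ)) ∈ boundaryGrid π :=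
    mem _ _ b d (by lia) (by lia) (by lia) (by lia)
  have hno : ((b : ℕ), (π a : ℕ)) ∉ boundaryGrid π := fun h' => by
    have := low _ _ h' le_rfl
    lia
  set G := downcoreGraph (boundaryGrid π) with hG
  have hind : G.IsIndepSet {⟨_, hm⟩, ⟨_, hg⟩, ⟨_, hh⟩} := by
    have e1 : ¬ G.Adj ⟨_, hm⟩ ⟨_, hg⟩ := fun e => by have := e.1; simp at this
    have e2 : ¬ G.Adj ⟨_, hm⟩ ⟨_, hh⟩ := fun e => by have := e.1; simp at this
    have e3 : ¬ G.Adj ⟨_, hg⟩ ⟨_, hh⟩ := fun e => hno e.2.1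
    rintro x (rfl | rfl | rfl) y (rfl | rfl | rfl) hne hadj
    all_goals first
      | exact hne rfl
      | exact e1 hadj
      | exact e2 hadj
      | exact e3 hadj
      | exact e1 hadj.symm
      | exact e2 hadj.symm
      | exact e3 hadj.symm
  obtain ⟨K, hle, hK⟩ := Finite.exists_le_maximal hind
  have hle' : _ ⊆ K := hle
  have hmK : (⟨_, hm⟩ : boundaryGrid π) ∈ K := hle' (by simp)
  have hgK : (⟨_, hg⟩ : boundaryGrid π) ∈ K := hle' (by simp)
  have hhK : (⟨_, hh⟩ : boundaryGrid π) ∈ K := hle' (by simp)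
  have hadj : ∀ e ∈ K, ∀ f ∈ K, ¬ G.Adj e f := fun e he f hf hef => hK.1 he hf hef.ne hef
  -- Boxes below `m` in this strip are adjacent to `g`.
  have hstrip : ∀ w ∈ K, w.1.1 = (b : ℕ) + 1 → (π a : ℕ) < w.1.2 → w.1.2 ≤ (π d : ℕ) →
      w = ⟨_, hm⟩ := by
    rintro ⟨⟨x, y⟩, hw⟩ hwK e1 e2 e3
    simp only at e1 e2 e3
    subst e1
    rcases e3.eq_or_lt with rfl | e3
    · rfl
    · exact absurd ⟨Or.inl ⟨Nat.lt_succ_self _, e3⟩,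
        mem _ _ a c (by lia) (by lia) (by lia) (by lia), hm⟩ (hadj _ hgK _ hwK)
  refine not_isPureGraph_of_exchange hK hmK (u := ⟨_, hu⟩) (v := ⟨_, hv⟩) (by simp)
    (fun e => hno e.2.1) ⟨Or.inl ⟨by simp, by simp⟩, hg, hum⟩
    ⟨Or.inr ⟨by simp, by simpa using h2⟩, hvm, hh⟩ ?_ ?_
  · rintro ⟨⟨x, y⟩, hw⟩ hwK ⟨hor, f1, f2⟩
    simp only at hor f1 f2
    rcases hor with ⟨e1, e2⟩ | ⟨e1, e2⟩
    · have e3 := low _ _ f1 le_rfl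
      have e4 : x ≤ b + 1 := by
        by_contra! hx
        have := high _ _ f2 (by lia)
        lia
      exact hstrip _ hwK (by simp only; lia) (by simp only; lia) (by simp only; lia)
    -- Such a `w` would be adjacent to `g`: its lower-left witness `i` precedes `d`, so `π i ≠ π d`
    -- and row `π d + 1` can be lowered to `π d`.
    · refine absurd ⟨Or.inr ⟨e1, (Nat.lt_succ_self _).trans e2⟩, f1, ?_⟩ (hadj _ hgK _ hwK)
      obtain ⟨⟨i, hi1, hi2⟩, ⟨k, hk1, hk2⟩⟩ := (mem_boundaryGrid_iff π _ _).1 f2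
      have hne : π i ≠ π d := fun e => by have := π.injective e; lia
      exact mem _ _ i k (by lia) (by lia) (by lia) (by lia)
  · rintro ⟨⟨x, y⟩, hw⟩ hwK ⟨hor, f1, f2⟩
    simp only at hor f1 f2
    rcases hor with ⟨e1, e2⟩ | ⟨e1, e2⟩
    -- Likewise `w` would be adjacent to `h`: the witness `i` is too low to be `c`, so column `b +
    -- 2` can be moved to `b + 1`.
    · refine absurd ⟨Or.inl ⟨(Nat.lt_succ_self _).trans e1, e2⟩, ?_, f2⟩ (hadj _ hhK _ hwK)
      obtain ⟨⟨i, hi1, hi2⟩, ⟨k, hk1, hk2⟩⟩ := (mem_boundaryGrid_iff π _ _).1 f1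
      have hne : i ≠ c := fun e => by subst e; lia
      exact mem _ _ i k (by lia) (by lia) (by lia) (by lia)
    · have e3 := high _ _ f1 le_rfl
      have e4 : (b : ℕ) + 1 ≤ x := by
        by_contra! hx
        have := low _ _ f2 (by lia)
        lia
      exact hstrip _ hwK (by simp only; lia) (by simp only; lia) (by simp only; lia)

theorem isPureGraph_downcoreGraph_iff {n : ℕ} {π : Equiv.Perm (Fin n)}
    (h123 : AvoidsPattern π pattern123) :
    IsPureGraph (downcoreGraph (boundaryGrid π)) ↔ AvoidsPattern π pattern2143 :=
  ⟨fun h h' => not_isPureGraph_of_containsPattern h123 h' h, isPureGraph_of_avoidsPattern⟩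

/-! ### Enumeration of the permutations avoiding `123` and `2143`. -/

/-- Insert an entry of value `v` at position `p` into a permutation, shifting the other entries. -/
def insertEntry {n : ℕ} (p v : Fin (n + 1)) (e : Equiv.Perm (Fin n)) : Equiv.Perm (Fin (n + 1)) :=
  (finSuccEquiv' p).trans (e.optionCongr.trans (finSuccEquiv' v).symm)

theorem insertEntry_apply_self {n : ℕ} (p v : Fin (n + 1)) (e : Equiv.Perm (Fin n)) :
    insertEntry p v e p = v := by
  simp [insertEntry]

theorem insertEntry_apply_succAbove {n : ℕ} (p v : Fin (n + 1)) (e : Equiv.Perm (Fin n))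
    (i : Fin n) : insertEntry p v e (p.succAbove i) = v.succAbove (e i) := by
  simp [insertEntry]

theorem insertEntry_injective {n : ℕ} (p v : Fin (n + 1)) :
    Function.Injective (insertEntry p v) := by
  intro e f h
  ext1 i
  have := DFunLike.congr_fun h (p.succAbove i)
  rwa [insertEntry_apply_succAbove, insertEntry_apply_succAbove, Fin.succAbove_right_inj] at this

theorem exists_insertEntry_eq {n : ℕ} {p v : Fin (n + 1)} {π : Equiv.Perm (Fin (n + 1))}
    (h : π p = v) : ∃ e, insertEntry p v e = π := by
  have hne : ∀ i : Fin n, ∃ j : Fin n, v.succAbove j = π (p.succAbove i) := fun i =>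
    Fin.exists_succAbove_eq fun h' => Fin.succAbove_ne p i (π.injective (h'.trans h.symm))
  choose f hf using hne
  have hinj : Function.Injective f := fun i j hij => by
    have := (hf i).symm.trans ((congrArg _ hij).trans (hf j))
    exact Fin.succAbove_right_injective (π.injective this)
  refine ⟨Equiv.ofBijective f (Finite.injective_iff_bijective.1 hinj), ?_⟩
  ext1 i
  rcases eq_or_ne i p with rfl | hi
  · rw [insertEntry_apply_self, h]
  · obtain ⟨j, rfl⟩ := Fin.exists_succAbove_eq hi
    rw [insertEntry_apply_succAbove, Equiv.ofBijective_apply, hf]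

theorem ContainsPattern.insertEntry {n k : ℕ} {e : Equiv.Perm (Fin n)} {σ : Equiv.Perm (Fin k)}
    (h : ContainsPattern e σ) (p v : Fin (n + 1)) : ContainsPattern (insertEntry p v e) σ := by
  obtain ⟨f, hf, ho⟩ := h
  refine ⟨fun j => p.succAbove (f j), (Fin.strictMono_succAbove p).comp hf, fun i j => ?_⟩
  simp only [insertEntry_apply_succAbove, Fin.succAbove_lt_succAbove_iff]
  exact ho i j

/-- The permutations avoiding both `123` and `2143`. -/
def avoiders (n : ℕ) : Set (Equiv.Perm (Fin n)) :=
  {π | AvoidsPattern π pattern123 ∧ AvoidsPattern π pattern2143}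

/-- The hypotheses say that an entry `v` at position `p` takes part in no occurrence of either
pattern, so every occurrence survives its deletion. -/
theorem insertEntry_mem_avoiders_iff {n : ℕ} {p v : Fin (n + 1)}
    (h123 : ∀ π : Equiv.Perm (Fin (n + 1)), π p = v →
      ∀ i j k, i < j → j < k → π i < π j → π j < π k → i ≠ p ∧ j ≠ p ∧ k ≠ p)
    (h2143 : ∀ π : Equiv.Perm (Fin (n + 1)), π p = v →
      ∀ a b c d, a < b → b < c → c < d → π b < π a → π a < π d → π d < π c →
        a ≠ p ∧ b ≠ p ∧ c ≠ p ∧ d ≠ p) (e : Equiv.Perm (Fin n)) :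
    insertEntry p v e ∈ avoiders (n + 1) ↔ e ∈ avoiders n := by
  constructor
  · exact fun h => ⟨fun h' => h.1 (h'.insertEntry p v), fun h' => h.2 (h'.insertEntry p v)⟩
  · rintro ⟨h1, h2⟩
    rw [avoidsPattern_pattern123_iff] at h1
    rw [avoidsPattern_pattern2143_iff] at h2
    have hp := insertEntry_apply_self p v e
    refine ⟨(avoidsPattern_pattern123_iff _).2 fun i j k hij hjk g1 g2 => ?_,
      (avoidsPattern_pattern2143_iff _).2 fun a b c d hab hbc hcd g1 g2 g3 => ?_⟩
    · obtain ⟨hi, hj, hk⟩ := h123 _ hp i j k hij hjk g1 g2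
      obtain ⟨i, rfl⟩ := Fin.exists_succAbove_eq hi
      obtain ⟨j, rfl⟩ := Fin.exists_succAbove_eq hj
      obtain ⟨k, rfl⟩ := Fin.exists_succAbove_eq hk
      simp only [insertEntry_apply_succAbove, Fin.succAbove_lt_succAbove_iff] at *
      exact h1 i j k hij hjk g1 g2
    · obtain ⟨ha, hb, hc, hd⟩ := h2143 _ hp a b c d hab hbc hcd g1 g2 g3
      obtain ⟨a, rfl⟩ := Fin.exists_succAbove_eq ha
      obtain ⟨b, rfl⟩ := Fin.exists_succAbove_eq hb
      obtain ⟨c, rfl⟩ := Fin.exists_succAbove_eq hc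
      obtain ⟨d, rfl⟩ := Fin.exists_succAbove_eq hd
      simp only [insertEntry_apply_succAbove, Fin.succAbove_lt_succAbove_iff] at *
      exact h2 a b c d hab hbc hcd g1 g2 g3

/-- `hv` places `v` among the two largest values, whereas a first entry used in either pattern needs
two larger entries after it. -/
theorem insertEntry_zero_mem_avoiders_iff {n : ℕ} {v : Fin (n + 1)} (hv : n ≤ (v : ℕ) + 1)
    (e : Equiv.Perm (Fin n)) : insertEntry 0 v e ∈ avoiders (n + 1) ↔ e ∈ avoiders n := by
  refine insertEntry_mem_avoiders_iff ?_ ?_ e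
  · intro π hπ i j k hij hjk g1 g2
    refine ⟨?_, by rintro rfl; simp at hij, by rintro rfl; simp at hjk⟩
    rintro rfl
    have := (π k).is_lt
    lia
  · intro π hπ a b c d hab hbc hcd g1 g2 g3
    refine ⟨?_, by rintro rfl; simp at hab, by rintro rfl; simp at hbc,
      by rintro rfl; simp at hcd⟩
    rintro rfl
    have := (π c).is_lt
    lia

/-- A maximum could only play the `3` of `123` or the `4` of `2143`, and both need two earlier
entries. -/
theorem insertEntry_one_mem_avoiders_iff {n : ℕ} (e : Equiv.Perm (Fin (n + 1))) :
    insertEntry 1 (Fin.last (n + 1)) e ∈ avoiders (n + 2) ↔ e ∈ avoiders (n + 1) := by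
  have one : ((1 : Fin (n + 2)) : ℕ) = 1 := by simp
  refine insertEntry_mem_avoiders_iff ?_ ?_ e
  · intro π hπ i j k hij hjk g1 g2
    have hle : ∀ i, π i ≤ π 1 := fun i => hπ ▸ Fin.le_last _
    refine ⟨?_, ?_, ?_⟩ <;> rintro rfl
    · exact absurd g1 (hle _).not_gt
    · exact absurd g2 (hle _).not_gt
    · lia
  · intro π hπ a b c d hab hbc hcd g1 g2 g3
    have hle : ∀ i, π i ≤ π 1 := fun i => hπ ▸ Fin.le_last _
    refine ⟨?_, ?_, ?_, ?_⟩ <;> rintro rfl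
    · exact absurd g2 (hle _).not_gt
    · exact absurd g1 (hle _).not_gt
    · lia
    · lia

/-- Suppose the maximum, at `p`, is not second. An ascent at the start gives a `123` ending at `p`.
After a descent, the second largest entry, at `r`, gives a `123` if it precedes `p` and a `2143` if
it follows. -/
theorem apply_one_eq_last {n : ℕ} {π : Equiv.Perm (Fin (n + 2))} (h : π ∈ avoiders (n + 2))
    (h0 : (π 0 : ℕ) < n) : π 1 = Fin.last (n + 1) := by
  obtain ⟨h1, h2⟩ := h
  rw [avoidsPattern_pattern123_iff] at h1
  rw [avoidsPattern_pattern2143_iff] at h2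
  have one : ((1 : Fin (n + 2)) : ℕ) = 1 := by simp
  have zero : ((0 : Fin (n + 2)) : ℕ) = 0 := by simp
  obtain ⟨p, hp⟩ := π.surjective (Fin.last (n + 1))
  obtain ⟨r, hr⟩ := π.surjective (Fin.last n).castSucc
  have hp' : (π p : ℕ) = n + 1 := by simp [hp]
  have hr' : (π r : ℕ) = n := by simp [hr]
  by_cases hp1 : p = 1
  · rw [← hp1, hp]
  exfalso
  have hp0 : p ≠ 0 := by rintro rfl; lia
  have hr0 : r ≠ 0 := by rintro rfl; lia
  have hpr : r ≠ p := by rintro rfl; lia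
  have h01 : π 0 ≠ π 1 := fun h => by have := π.injective h; simp at this
  by_cases hlt : π 0 < π 1
  · refine h1 0 1 p (by lia) (by lia) hlt ?_
    have := (π 1).is_lt
    have : π 1 ≠ π p := fun h => hp1 (π.injective h).symm
    lia
  · have hr1 : r ≠ 1 := by rintro rfl; lia
    rcases lt_or_gt_of_ne hpr with hlt' | hlt'
    · exact h1 0 r p (by lia) hlt' (by lia) (by lia)
    · exact h2 0 1 p r (by lia) (by lia) hlt' (by lia) (by lia) (by lia)

theorem avoiders_first_eq {n : ℕ} (v : Fin (n + 1)) (hv : n ≤ (v : ℕ) + 1) :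
    {π ∈ avoiders (n + 1) | π 0 = v} = insertEntry 0 v '' avoiders n := by
  ext π
  constructor
  · rintro ⟨h, h0⟩
    obtain ⟨e, rfl⟩ := exists_insertEntry_eq h0
    exact ⟨e, (insertEntry_zero_mem_avoiders_iff hv e).1 h, rfl⟩
  · rintro ⟨e, he, rfl⟩
    exact ⟨(insertEntry_zero_mem_avoiders_iff hv e).2 he, insertEntry_apply_self _ _ _⟩

theorem avoiders_first_lt {n : ℕ} :
    {π ∈ avoiders (n + 2) | (π 0 : ℕ) < n} =
      insertEntry 1 (Fin.last (n + 1)) '' {e ∈ avoiders (n + 1) | e 0 ≠ Fin.last n} := by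
  have key : ∀ e : Equiv.Perm (Fin (n + 1)),
      (insertEntry 1 (Fin.last (n + 1)) e 0 : ℕ) = e 0 := fun e => by
    have h := insertEntry_apply_succAbove 1 (Fin.last (n + 1)) e 0
    rw [Fin.succAbove_last, show (1 : Fin (n + 2)).succAbove 0 = 0 by simp] at h
    simp [h]
  have key' : ∀ x : Fin (n + 1), x ≠ Fin.last n ↔ (x : ℕ) < n := fun x => by
    rw [Ne, Fin.ext_iff, Fin.val_last]
    lia
  ext π
  constructor
  · rintro ⟨h, h0⟩
    obtain ⟨e, rfl⟩ := exists_insertEntry_eq (apply_one_eq_last h h0)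
    exact ⟨e, ⟨(insertEntry_one_mem_avoiders_iff e).1 h, (key' _).2 (key e ▸ h0)⟩, rfl⟩
  · rintro ⟨e, ⟨he, h0⟩, rfl⟩
    exact ⟨(insertEntry_one_mem_avoiders_iff e).2 he, (key e).symm ▸ (key' _).1 h0⟩

/-- Split by first entry: largest, second largest, or smaller. The first two classes each have the
size of `avoiders (n + 1)`; the third has that size less the avoiders starting with their maximum,
which are counted by `avoiders n`. -/
theorem ncard_avoiders_add_two (n : ℕ) :
    (avoiders (n + 2)).ncard + (avoiders n).ncard = 3 * (avoiders (n + 1)).ncard := by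
  have h1 : {π ∈ avoiders (n + 2) | π 0 = Fin.last (n + 1)}.ncard = (avoiders (n + 1)).ncard := by
    rw [avoiders_first_eq _ (by simp), Set.ncard_image_of_injective _ (insertEntry_injective _ _)]
  have h2 : {π ∈ avoiders (n + 2) | π 0 = (Fin.last n).castSucc}.ncard =
      (avoiders (n + 1)).ncard := by
    rw [avoiders_first_eq _ (by simp), Set.ncard_image_of_injective _ (insertEntry_injective _ _)]
  have h3 : {π ∈ avoiders (n + 2) | (π 0 : ℕ) < n}.ncard =
      {e ∈ avoiders (n + 1) | e 0 ≠ Fin.last n}.ncard := by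
    rw [avoiders_first_lt, Set.ncard_image_of_injective _ (insertEntry_injective _ _)]
  have h4 : {e ∈ avoiders (n + 1) | e 0 = Fin.last n}.ncard = (avoiders n).ncard := by
    rw [avoiders_first_eq _ (by simp), Set.ncard_image_of_injective _ (insertEntry_injective _ _)]
  have h5 : (avoiders (n + 1)).ncard = {e ∈ avoiders (n + 1) | e 0 = Fin.last n}.ncard +
      {e ∈ avoiders (n + 1) | e 0 ≠ Fin.last n}.ncard := by
    rw [← Set.ncard_union_eq (Set.disjoint_left.2 fun e h h' => h'.2 h.2)]
    congr 1
    ext e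
    simp only [Set.mem_union, Set.mem_ofPred_eq]
    tauto
  have h6 : (avoiders (n + 2)).ncard = {π ∈ avoiders (n + 2) | π 0 = Fin.last (n + 1)}.ncard +
      {π ∈ avoiders (n + 2) | π 0 = (Fin.last n).castSucc}.ncard +
      {π ∈ avoiders (n + 2) | (π 0 : ℕ) < n}.ncard := by
    rw [← Set.ncard_union_eq, ← Set.ncard_union_eq]
    · congr 1
      ext π
      have := (π 0).is_lt
      simp only [Set.mem_union, Set.mem_ofPred_eq, Fin.ext_iff, Fin.val_last, Fin.val_castSucc,
        ← and_or_left]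
      exact ⟨fun h => ⟨h, by lia⟩, fun h => h.1⟩
    · refine Set.disjoint_left.2 fun π h h' => ?_
      simp only [Set.mem_union, Set.mem_ofPred_eq, Fin.ext_iff, Fin.val_last, Fin.val_castSucc] at h h'
      lia
    · refine Set.disjoint_left.2 fun π h h' => ?_
      simp only [Set.mem_ofPred_eq, Fin.ext_iff, Fin.val_last, Fin.val_castSucc] at h h'
      lia
  lia

theorem avoiders_eq_univ {n : ℕ} (hn : n ≤ 1) : avoiders n = Set.univ := by
  refine Set.eq_univ_of_forall fun π => ⟨?_, ?_⟩
  · exact (avoidsPattern_pattern123_iff π).2 fun i j _ _ _ _ _ => by lia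
  · exact (avoidsPattern_pattern2143_iff π).2 fun a b _ _ _ _ _ _ _ _ => by lia

theorem ncard_avoiders_succ (n : ℕ) : (avoiders (n + 1)).ncard = Nat.fib (2 * n + 1) := by
  induction n using Nat.strong_induction_on with
  | _ n ih =>
    match n with
    | 0 => simp [avoiders_eq_univ, Set.ncard_univ]
    | 1 =>
      have h := ncard_avoiders_add_two 0
      have h0 : (avoiders 0).ncard = 1 := by simp [avoiders_eq_univ, Set.ncard_univ]
      have h1 : (avoiders 1).ncard = 1 := by simp [avoiders_eq_univ, Set.ncard_univ]
      simp only [h0, h1] at h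
      simp [Nat.fib_add_two]
      lia
    | m + 2 =>
      have h := ncard_avoiders_add_two (m + 1)
      rw [ih m (by lia), ih (m + 1) (by lia)] at h
      have e1 : Nat.fib (2 * m + 2) = _ := Nat.fib_add_two
      have e2 : Nat.fib (2 * m + 3) = _ := Nat.fib_add_two
      have e3 : Nat.fib (2 * m + 4) = _ := Nat.fib_add_two
      have e4 : Nat.fib (2 * m + 5) = _ := Nat.fib_add_two
      rw [show 2 * (m + 1) + 1 = 2 * m + 3 by ring] at h
      rw [show 2 * (m + 2) + 1 = 2 * m + 5 by ring]
      lia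

theorem mainTheorem7 (n : ℕ) :
    (∀ π ∈ Av n pattern123,
      IsPureGraph (downcoreGraph (boundaryGrid π)) ↔ AvoidsPattern π pattern2143) ∧
    (1 ≤ n →
      {π ∈ Av n pattern123 | IsPureGraph (downcoreGraph (boundaryGrid π))}.ncard =
        Nat.fib (2 * n - 1)) := by
  refine ⟨fun π hπ => isPureGraph_downcoreGraph_iff hπ, fun hn => ?_⟩
  obtain ⟨m, rfl⟩ := Nat.exists_eq_add_of_le' hn
  rw [show 2 * (m + 1) - 1 = 2 * m + 1 by lia, ← ncard_avoiders_succ m]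
  congr 1
  ext π
  exact and_congr_right fun hπ => isPureGraph_downcoreGraph_iff hπ
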